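/- Let $p_1,p_2,p_3\in\mathbb R^2$ be the vertices of a regular triangle with $p_1+p_2+p_3=0$ and $|p_i-p_j|=1$ $(i\ne j)$, let $\alpha\in(0,1)$, $S=\{1,2,3\}$, $G_i(x)=\frac{1-\alpha}{2}(x-p_i)+p_i$ and $G_w=G_{w_1}\circ\cdots\circ G_{w_m}$ for a word $w=w_1\cdots w_m\in W_m=S^m$ ($W_0=\{\emptyset\}$, $G_\emptyset=\mathrm{id}$, $W_*=\bigcup_m W_m$). For $(i,j)\in B=\{(1,2),(2,3),(3,1)\}$ let $e_{ij}$ be the segment joining $G_i(p_j)$ and $G_j(p_i)$, and $e^w_{ij}=G_w(e_{ij})$. Let $\Sigma$ be the nonempty compact set with $\Sigma=\bigcup_i G_i(\Sigma)$ (a Cantor set), and let $K=\Sigma\cup\bigcup_{(w,(i,j))\in W_*\times B}e^w_{ij}$ be the stretched Sierpinski gasket, with the Euclidean topology. For a segment $e=pq$ put $\xi(t)=(1-t)p+tq$; write $u\in H^1(e)$ if $u\circ\xi$ is continuous on $[0,1]$ with distributional derivative in $L^2$, and $\mathcal D_e(u,v)=\int_0^1(u\circ\xi)'(v\circ\xi)'\,dt$.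 For $k\ge1$ let $$\mathcal D^I_k(u,v)=\sum_{w\in W_{k-1}}\ \sum_{(i,j)\in B}\mathcal D_{e^w_{ij}}(u,v).$$ A resistance form on a set $X$ is a pair $(\mathcal E,\mathcal F)$ such that: $\mathcal F$ is a linear space of functions $X\to\mathbb R$ containing the constants, $\mathcal E$ is a nonnegative symmetric bilinear form on $\mathcal F$, and $\mathcal E(u,u)=0$ if and only if $u$ is constant; $\mathcal F$ modulo constants is a Hilbert space under $\mathcal E$; $\mathcal F$ separates the points of $X$; $R(p,q)=\sup\{|u(p)-u(q)|^2/\mathcal E(u,u): u\in\mathcal F,\ \mathcal E(u,u)>0\}<\infty$ for all $p,q\in X$; and for $u\in\mathcal F$ also $\bar u=\max(0,\min(1,u))\in\mathcal F$, with $\mathcal E(\bar u,\bar u)\le\mathcal E(u,u)$. Let $\mathcal{RF}^{(0)}_S$ be the set of resistance forms $(\mathcal E,\mathcal F)$ on $K$ such that: (a) $\mathcal F\subseteq C(K)$, and $u:K\to\mathbb R$ is in $\mathcal F$ if and only if $u|_{G_i(K)}\in\{v|_{G_i(K)}:v\in\mathcal F\}$ for all $i\in S$ and $u|_{e_{ij}}\in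 H^1(e_{ij})$ for all $(i,j)\in B$; (b) the resistance metric $R$ induces the Euclidean topology of $K$; (c) for every linear $\varphi:\mathbb R^2\to\mathbb R^2$ with $\varphi(K)=K$ and every $u\in\mathcal F$, $u\circ\varphi\in\mathcal F$ and $\mathcal E(u\circ\varphi,u\circ\varphi)=\mathcal E(u,u)$. A form $(\mathcal E,\mathcal F)\in\mathcal{RF}^{(0)}_S$ is completely symmetric, $(\mathcal E,\mathcal F)\in\mathcal{RF}_S$, if it has a resolution, i.e. there are $(\mathcal E_m,\mathcal F_m)\in\mathcal{RF}_S^{(0)}$ $(m\ge0)$ and $\eta_m>0$ $(m\ge1)$ with $(\mathcal E_0,\mathcal F_0)=(\mathcal E,\mathcal F)$ and, for all $m\ge1$, $\mathcal F_m=\{u\circ G_i:u\in\mathcal F_{m-1}\}$ for every $i\in S$ and $$\mathcal E_{m-1}(u,v)=\sum_{i=1}^3\mathcal E_m(u\circ G_i,v\circ G_i)+\frac1{\eta_m}\mathcal D^I_1(u,v)\qquad(u,v\in\mathcal F_{m-1}).$$ For $u\in\mathcal F$ let $h_\Sigma(u)$ be the $\Sigma$-harmonic extension of $u|_\Sigma$,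 i.e. the unique minimizer of $\mathcal E(v,v)$ among the $v\in\mathcal F$ with $v|_\Sigma=u|_\Sigma$. Let $\mathcal H_{(\mathcal E,\mathcal F)}(\Sigma)=\{h_\Sigma(u):u\in\mathcal F\}$, $\mathcal F(\Sigma)=\{u\in\mathcal F:u|_\Sigma=0\}$, and let $\mathcal E|_\Sigma(u|_\Sigma,v|_\Sigma)=\mathcal E(h_\Sigma(u),h_\Sigma(v))$ be the trace of $\mathcal E$ on $\Sigma$. **Theorem.** Let $(\mathcal E,\mathcal F)\in\mathcal{RF}_S$ and let $\{(\mathcal E_m,\mathcal F_m,\eta_m)\}$ be a resolution of it. Then $$\mathcal F=\mathcal H_{(\mathcal E,\mathcal F)}(\Sigma)\oplus\mathcal F(\Sigma).$$ Moreover, every $u\in\mathcal F$ is continuous and belongs to $H^1(e^w_{ij})$ for all $(w,(i,j))\in W_*\times B$, and for every $u\in\mathcal F$ $$\mathcal E(u,u)=\mathcal E|_\Sigma(u|_\Sigma,u|_\Sigma)+\sum_{k=1}^\infty\frac1{\eta_k}\,\mathcal D^I_k\big(u-h_\Sigma(u),\,u-h_\Sigma(u)\big),$$ where the series converges. -/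

import Mathlib

open Filter Topology MeasureTheory
open scoped ContDiff

noncomputable section

/-! ## Resistance forms -/

/-- A resistance form `(E, F)` on a set `X`: `dom` is `F`, `form` is `E`. -/
structure ResistanceForm (X : Type*) where
  dom : Submodule ℝ (X → ℝ)
  form : dom →ₗ[ℝ] dom →ₗ[ℝ] ℝ
  const_mem : ∀ c : ℝ, (fun _ : X => c) ∈ dom
  symm : ∀ u v : dom, form u v = form v u
  nonneg : ∀ u : dom, 0 ≤ form u u
  eq_zero_iff : ∀ u : dom, form u u = 0 ↔ ∃ c : ℝ, ∀ x, (u : X → ℝ) x = c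
  /-- Completeness of `F` modulo constants for the norm `E(u, u)^{1/2}`. -/
  complete : ∀ u : ℕ → dom,
    (∀ ε : ℝ, 0 < ε → ∃ N, ∀ m ≥ N, ∀ n ≥ N, form (u m - u n) (u m - u n) < ε) →
    ∃ v : dom, Tendsto (fun n => form (u n - v) (u n - v)) atTop (𝓝 0)
  separates : ∀ x y : X, x ≠ y → ∃ u ∈ dom, u x ≠ u y
  bddAbove : ∀ p q : X, BddAbove {r : ℝ | ∃ u : dom, 0 < form u u ∧
    r = |(u : X → ℝ) p - (u : X → ℝ) q| ^ 2 / form u u}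
  markov : ∀ u : dom, ∃ h : (fun x => max 0 (min 1 ((u : X → ℝ) x))) ∈ dom,
    form ⟨_, h⟩ ⟨_, h⟩ ≤ form u u

namespace ResistanceForm

variable {X : Type*} (E : ResistanceForm X)

/-- The resistance metric `R(p, q)` associated with the form. -/
def resistance (p q : X) : ℝ :=
  sSup {r : ℝ | ∃ u : E.dom, 0 < E.form u u ∧
    r = |(u : X → ℝ) p - (u : X → ℝ) q| ^ 2 / E.form u u}

/-- The restriction map `u ↦ u|_Y`. -/
def restr (Y : Set X) : (X → ℝ) →ₗ[ℝ] (Y → ℝ) where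
  toFun u := Y.domRestrict u
  map_add' _ _ := rfl
  map_smul' _ _ := rfl

/-- `F|_Y = {u|_Y : u ∈ F}`. -/
def traceDom (Y : Set X) : Submodule ℝ (Y → ℝ) := E.dom.map (restr Y)

/-- The restriction map `F → F|_Y`. -/
def toTrace (Y : Set X) : E.dom →ₗ[ℝ] E.traceDom Y :=
  (restr Y).restrict fun _ hu => Submodule.mem_map_of_mem hu

/-- `{u ∈ F : u|_Y = 0}`. -/
def vanishing (Y : Set X) : Submodule ℝ E.dom where
  carrier := {u | ∀ x ∈ Y, (u : X → ℝ) x = 0}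
  zero_mem' := fun _ _ => rfl
  add_mem' := fun {u v} hu hv x hx => by
    have h1 := hu x hx
    have h2 := hv x hx
    simp [h1, h2]
  smul_mem' := fun c u hu x hx => by
    have h1 := hu x hx
    simp [h1]

/-- `u` is an energy minimizer in `F` among the functions with boundary value `f` on `Y`. -/
def IsHarmonicExt (Y : Set X) (f : E.traceDom Y) (u : E.dom) : Prop :=
  E.toTrace Y u = f ∧ ∀ v : E.dom, E.toTrace Y v = f → E.form u u ≤ E.form v v

theorem toTrace_eq_iff {Y : Set X} {u v : E.dom} :
    E.toTrace Y u = E.toTrace Y v ↔ ∀ x ∈ Y, (u : X → ℝ) x = (v : X → ℝ) x := by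
  constructor
  · intro h x hx
    exact congrFun (congrArg Subtype.val h) ⟨x, hx⟩
  · intro h
    apply Subtype.ext
    funext x
    exact h x.1 x.2

theorem mem_vanishing_iff {Y : Set X} {u : E.dom} :
    u ∈ E.vanishing Y ↔ E.toTrace Y u = 0 := by
  rw [← map_zero (E.toTrace Y), toTrace_eq_iff]
  rfl

theorem toTrace_surjective (Y : Set X) : Function.Surjective (E.toTrace Y) := by
  rintro ⟨f, u, hu, rfl⟩
  exact ⟨⟨u, hu⟩, rfl⟩

theorem form_add_self (u v : E.dom) :
    E.form (u + v) (u + v) = E.form u u + 2 * E.form u v + E.form v v := by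
  have := E.symm u v
  simp only [map_add, LinearMap.add_apply]
  linarith

theorem form_smul_self (t : ℝ) (v : E.dom) :
    E.form (t • v) (t • v) = t ^ 2 * E.form v v := by
  simp only [map_smul, LinearMap.smul_apply, smul_eq_mul]
  ring

/-- Minimality is orthogonality to the functions vanishing on `Y`. -/
theorem isHarmonicExt_iff {Y : Set X} {f : E.traceDom Y} {u : E.dom} :
    E.IsHarmonicExt Y f u ↔ E.toTrace Y u = f ∧ ∀ v ∈ E.vanishing Y, E.form u v = 0 := by
  constructor
  · rintro ⟨h1, h2⟩
    refine ⟨h1, fun v hv => ?_⟩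
    have hv0 := E.mem_vanishing_iff.1 hv
    have key : ∀ t : ℝ, 0 ≤ 2 * t * E.form u v + t ^ 2 * E.form v v := by
      intro t
      have h3 := h2 (u + t • v) (by rw [map_add, map_smul, hv0, h1]; simp)
      rw [form_add_self, form_smul_self, map_smul, smul_eq_mul] at h3
      linarith
    by_contra hne
    have hv1 := E.nonneg v
    have hb : (0 : ℝ) < E.form v v + 1 := by linarith
    have h4 := key (-(E.form u v) / (E.form v v + 1))
    have h5 : 2 * (-(E.form u v) / (E.form v v + 1)) * E.form u v
        + (-(E.form u v) / (E.form v v + 1)) ^ 2 * E.form v v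
        = -((E.form u v) ^ 2 * (E.form v v + 2)) / (E.form v v + 1) ^ 2 := by
      field_simp
      ring
    rw [h5] at h4
    have h6 : 0 < (E.form u v) ^ 2 * (E.form v v + 2) := by positivity
    have h7 : -((E.form u v) ^ 2 * (E.form v v + 2)) / (E.form v v + 1) ^ 2 < 0 :=
      div_neg_of_neg_of_pos (by linarith) (by positivity)
    linarith
  · rintro ⟨h1, h2⟩
    refine ⟨h1, fun v hv => ?_⟩
    have hw : v - u ∈ E.vanishing Y := by
      rw [mem_vanishing_iff, map_sub, hv, h1, sub_self]
    have h3 := E.form_add_self u (v - u)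
    rw [h2 _ hw, add_sub_cancel] at h3
    have := E.nonneg (v - u)
    linarith

theorem sq_sub_le (u : E.dom) (p q : X) :
    |(u : X → ℝ) p - (u : X → ℝ) q| ^ 2 ≤ E.resistance p q * E.form u u := by
  rcases (E.nonneg u).eq_or_lt with h | h
  · obtain ⟨c, hc⟩ := (E.eq_zero_iff u).1 h.symm
    simp [hc, ← h]
  · rw [← div_le_iff₀ h]
    exact le_csSup (E.bddAbove p q) ⟨u, h, rfl⟩

theorem isHarmonicExt_unique {Y : Set X} (hY : Y.Nonempty) {f : E.traceDom Y} {u v : E.dom}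
    (hu : E.IsHarmonicExt Y f u) (hv : E.IsHarmonicExt Y f v) : u = v := by
  rw [isHarmonicExt_iff] at hu hv
  have hw : u - v ∈ E.vanishing Y := by
    rw [mem_vanishing_iff, map_sub, hu.1, hv.1, sub_self]
  have h0 : E.form (u - v) (u - v) = 0 := by
    have h1 := hu.2 _ hw
    have h2 := hv.2 _ hw
    rw [map_sub E.form u v, LinearMap.sub_apply, h1, h2, sub_zero]
  obtain ⟨c, hc⟩ := (E.eq_zero_iff _).1 h0
  obtain ⟨y, hy⟩ := hY
  have hc0 : c = 0 := by rw [← hc y]; exact hw y hy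
  apply sub_eq_zero.1
  apply Subtype.ext
  funext x
  rw [hc x, hc0]
  rfl

theorem exists_isHarmonicExt {Y : Set X} (hY : Y.Nonempty) (f : E.traceDom Y) :
    ∃ u, E.IsHarmonicExt Y f u := by
  obtain ⟨y, hy⟩ := hY
  obtain ⟨u₀, hu₀⟩ := E.toTrace_surjective Y f
  set S : Set ℝ := {r | ∃ v : E.dom, E.toTrace Y v = f ∧ r = E.form v v} with hS
  have hSne : S.Nonempty := ⟨_, u₀, hu₀, rfl⟩
  have hSb : BddBelow S := ⟨0, by rintro r ⟨v, -, rfl⟩; exact E.nonneg v⟩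
  set I := sInf S with hI
  have hIle : ∀ v : E.dom, E.toTrace Y v = f → I ≤ E.form v v :=
    fun v hv => csInf_le hSb ⟨v, hv, rfl⟩
  have hseq : ∀ n : ℕ, ∃ v : E.dom, E.toTrace Y v = f ∧ E.form v v < I + 1 / ((n : ℝ) + 1) := by
    intro n
    obtain ⟨r, ⟨v, hv, rfl⟩, hlt⟩ :=
      exists_lt_of_csInf_lt hSne (lt_add_of_pos_right I (Nat.one_div_pos_of_nat (α := ℝ) (n := n)))
    exact ⟨v, hv, hlt⟩
  choose v hv hvlt using hseq
  have hpar : ∀ a b : E.dom, E.toTrace Y a = f → E.toTrace Y b = f →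
      E.form (a - b) (a - b) ≤ 2 * E.form a a + 2 * E.form b b - 4 * I := by
    intro a b ha hb
    have hm := hIle ((1 / 2 : ℝ) • (a + b)) (by
      rw [map_smul, map_add, ha, hb, ← two_smul ℝ f, smul_smul]; norm_num)
    rw [form_smul_self, form_add_self] at hm
    have h1 := E.form_add_self a ((-1 : ℝ) • b)
    rw [form_smul_self, map_smul, smul_eq_mul] at h1
    have h2 : a - b = a + (-1 : ℝ) • b := by module
    rw [h2, h1]
    linarith
  obtain ⟨w, hw⟩ := E.complete v (by
    intro ε hε
    obtain ⟨N, hN⟩ := exists_nat_one_div_lt (show (0 : ℝ) < ε / 4 by linarith)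
    refine ⟨N, fun m hm n hn => ?_⟩
    have h1 := hpar _ _ (hv m) (hv n)
    have h2 := hvlt m
    have h3 := hvlt n
    have h4 : 1 / ((m : ℝ) + 1) ≤ 1 / ((N : ℝ) + 1) := Nat.one_div_le_one_div hm
    have h5 : 1 / ((n : ℝ) + 1) ≤ 1 / ((N : ℝ) + 1) := Nat.one_div_le_one_div hn
    linarith)
  have hvy : ∀ n, ∀ x ∈ Y, (v n : X → ℝ) x = (v 0 : X → ℝ) x := fun n =>
    E.toTrace_eq_iff.1 ((hv n).trans (hv 0).symm)
  -- on `Y`, the limit differs from the boundary value by a constant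
  have hpt : ∀ x ∈ Y, (v 0 : X → ℝ) x - (w : X → ℝ) x
      = (v 0 : X → ℝ) y - (w : X → ℝ) y := by
    intro x hx
    have hlim : Tendsto (fun n => E.resistance x y * E.form (v n - w) (v n - w)) atTop (𝓝 0) := by
      simpa using hw.const_mul (E.resistance x y)
    have hle : |((v 0 : X → ℝ) x - (w : X → ℝ) x) - ((v 0 : X → ℝ) y - (w : X → ℝ) y)| ^ 2 ≤ 0 := by
      refine ge_of_tendsto' hlim fun n => ?_
      have h1 := E.sq_sub_le (v n - w) x y
      have h2 : ((v n - w : E.dom) : X → ℝ) x = (v 0 : X → ℝ) x - (w : X → ℝ) x := by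
        rw [← hvy n x hx]; rfl
      have h3 : ((v n - w : E.dom) : X → ℝ) y = (v 0 : X → ℝ) y - (w : X → ℝ) y := by
        rw [← hvy n y hy]; rfl
      rwa [h2, h3] at h1
    have h4 := abs_eq_zero.1 (pow_eq_zero_iff two_ne_zero |>.1 (le_antisymm hle (sq_nonneg _)))
    linarith
  set c : E.dom := ⟨_, E.const_mem ((v 0 : X → ℝ) y - (w : X → ℝ) y)⟩ with hc
  have hcc : E.form c c = 0 := (E.eq_zero_iff c).2 ⟨_, fun _ => rfl⟩
  have htr : E.toTrace Y (w + c) = f := by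
    rw [← hv 0, toTrace_eq_iff]
    intro x hx
    have h := hpt x hx
    change (w : X → ℝ) x + ((v 0 : X → ℝ) y - (w : X → ℝ) y) = _
    linarith
  have hcz : ∀ a : E.dom, E.form a c = 0 := by
    have hh : E.IsHarmonicExt (∅ : Set X) (E.toTrace ∅ c) c :=
      ⟨rfl, fun a _ => by rw [hcc]; exact E.nonneg a⟩
    intro a
    rw [E.symm]
    exact (E.isHarmonicExt_iff.1 hh).2 a (fun x hx => hx.elim)
  refine ⟨w + c, htr, fun a ha => ?_⟩
  have hwI : E.form (w + c) (w + c) ≤ I := by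
    have hww : E.form (w + c) (w + c) = E.form w w := by
      rw [form_add_self, hcc, hcz]; ring
    rw [hww]
    -- `E(w) ≤ (1 + δ) E(v n) + (1 + 1/δ) E(w - v n)`
    have hq : ∀ δ : ℝ, 0 < δ → E.form w w ≤ (1 + δ) * I := by
      intro δ hδ
      have hlim : Tendsto (fun n : ℕ => (1 + δ) * (I + 1 / ((n : ℝ) + 1))
          + (1 + 1 / δ) * E.form (v n - w) (v n - w)) atTop
          (𝓝 ((1 + δ) * (I + 0) + (1 + 1 / δ) * 0)) :=
        ((tendsto_one_div_add_atTop_nhds_zero_nat.const_add I).const_mul _).add (hw.const_mul _)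
      have hlim' := ge_of_tendsto' hlim (b := E.form w w) (fun n => by
        have h1 := hvlt n
        have h2 := E.form_add_self (v n) ((-1 : ℝ) • (v n - w))
        have h3 : v n + (-1 : ℝ) • (v n - w) = w := by module
        rw [h3, form_smul_self, map_smul, smul_eq_mul] at h2
        have h4 := E.nonneg (δ • v n + (v n - w))
        rw [form_add_self, form_smul_self, map_smul, LinearMap.smul_apply, smul_eq_mul] at h4
        have h5 : -(2 * E.form (v n) (v n - w))
            ≤ δ * E.form (v n) (v n) + 1 / δ * E.form (v n - w) (v n - w) := by
          have h6 : 0 ≤ (δ ^ 2 * E.form (v n) (v n) + 2 * (δ * E.form (v n) (v n - w))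
              + E.form (v n - w) (v n - w)) / δ := div_nonneg h4 hδ.le
          have h7 : (δ ^ 2 * E.form (v n) (v n) + 2 * (δ * E.form (v n) (v n - w))
              + E.form (v n - w) (v n - w)) / δ
              = δ * E.form (v n) (v n) + 2 * E.form (v n) (v n - w)
                + 1 / δ * E.form (v n - w) (v n - w) := by
            field_simp
          linarith
        have h8 : (1 + δ) * E.form (v n) (v n) ≤ (1 + δ) * (I + 1 / ((n : ℝ) + 1)) :=
          mul_le_mul_of_nonneg_left h1.le (by linarith)
        linarith)
      linarith
    have hlim2 : Tendsto (fun δ : ℝ => (1 + δ) * I) (𝓝[>] 0) (𝓝 ((1 + 0) * I)) := by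
      apply Tendsto.mono_left _ nhdsWithin_le_nhds
      exact ((continuous_const.add continuous_id).mul continuous_const).tendsto 0
    have := ge_of_tendsto hlim2 (by
      filter_upwards [self_mem_nhdsWithin] with δ hδ using hq δ hδ)
    simpa using this
  exact hwI.trans (hIle a ha)

/-- The `Y`-harmonic extension map `h_Y : F|_Y → F`: `h_Y(f)` is the unique energy minimizer
with boundary value `f` (see `harmonicExt_spec`). -/
def harmonicExt (Y : Set X) (hY : Y.Nonempty) : E.traceDom Y →ₗ[ℝ] E.dom where
  toFun f := (E.exists_isHarmonicExt hY f).choose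
  map_add' f g := by
    have hf := E.isHarmonicExt_iff.1 (E.exists_isHarmonicExt hY f).choose_spec
    have hg := E.isHarmonicExt_iff.1 (E.exists_isHarmonicExt hY g).choose_spec
    refine E.isHarmonicExt_unique hY (E.exists_isHarmonicExt hY (f + g)).choose_spec
      (E.isHarmonicExt_iff.2 ⟨by rw [map_add, hf.1, hg.1], fun v hv => ?_⟩)
    rw [map_add, LinearMap.add_apply, hf.2 v hv, hg.2 v hv, add_zero]
  map_smul' t f := by
    have hf := E.isHarmonicExt_iff.1 (E.exists_isHarmonicExt hY f).choose_spec
    refine E.isHarmonicExt_unique hY (E.exists_isHarmonicExt hY (t • f)).choose_spec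
      (E.isHarmonicExt_iff.2 ⟨by rw [RingHom.id_apply, map_smul, hf.1], fun v hv => ?_⟩)
    rw [RingHom.id_apply, map_smul, LinearMap.smul_apply, hf.2 v hv, smul_zero]

theorem harmonicExt_spec {Y : Set X} (hY : Y.Nonempty) (f : E.traceDom Y) :
    E.IsHarmonicExt Y f (E.harmonicExt Y hY f) :=
  (E.exists_isHarmonicExt hY f).choose_spec

/-- The space `H(Y) = h_Y(F|_Y)` of `Y`-harmonic functions. -/
def harmonic (Y : Set X) (hY : Y.Nonempty) : Submodule ℝ E.dom :=
  LinearMap.range (E.harmonicExt Y hY)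

/-- `h_Y(u)`, the `Y`-harmonic extension of `u|_Y`, for `u ∈ F`. -/
def harmonicPart (Y : Set X) (hY : Y.Nonempty) (u : E.dom) : E.dom :=
  E.harmonicExt Y hY (E.toTrace Y u)

/-- The trace form `E|_Y(f, g) = E(h_Y(f), h_Y(g))` on `F|_Y`. -/
def traceForm (Y : Set X) (hY : Y.Nonempty) (f g : E.traceDom Y) : ℝ :=
  E.form (E.harmonicExt Y hY f) (E.harmonicExt Y hY g)

end ResistanceForm

/-! ## The Sobolev space `H¹([0, 1])` -/

/-- `g` is the derivative of `f` on `(0, 1)` in the sense of distributions. -/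
def IsWeakDeriv (f g : unitInterval → ℝ) : Prop :=
  ∀ φ : ℝ → ℝ, ContDiff ℝ ∞ φ → HasCompactSupport φ → tsupport φ ⊆ Set.Ioo 0 1 →
    ∫ t : unitInterval, f t * deriv φ t = - ∫ t : unitInterval, g t * φ t

/-- `f ∈ H¹([0, 1])`; as usual in dimension one, members are represented by their
continuous version. -/
def MemH1 (f : unitInterval → ℝ) : Prop :=
  Continuous f ∧ ∃ g : unitInterval → ℝ, MemLp g 2 volume ∧ IsWeakDeriv f g

open Classical in
/-- The square integrable weak derivative of `f`, unique up to null sets (`0` if there is none). -/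
def weakDeriv (f : unitInterval → ℝ) : unitInterval → ℝ :=
  if h : ∃ g : unitInterval → ℝ, MemLp g 2 volume ∧ IsWeakDeriv f g then h.choose else 0

/-- `∫₀¹ f' g' dx`. -/
def dirichletIntegral (f g : unitInterval → ℝ) : ℝ :=
  ∫ t : unitInterval, weakDeriv f t * weakDeriv g t

/-! ## The stretched Sierpinski gasket -/

/-- The data of the construction: the vertices of a regular triangle with side `1` centred at
the origin of the Euclidean plane, and the stretching parameter `α ∈ (0, 1)`. -/
structure StretchData where
  p : Fin 3 → EuclideanSpace ℝ (Fin 2)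
  α : ℝ
  sum_eq_zero : p 0 + p 1 + p 2 = 0
  dist_eq_one : ∀ i j, i ≠ j → dist (p i) (p j) = 1
  α_pos : 0 < α
  α_lt_one : α < 1

namespace StretchData

variable (T : StretchData)

/-- The contraction `G_i(x) = (1 - α)/2 (x - p_i) + p_i`. -/
def G (i : Fin 3) (x : EuclideanSpace ℝ (Fin 2)) : EuclideanSpace ℝ (Fin 2) :=
  ((1 - T.α) / 2) • (x - T.p i) + T.p i

/-- `G_w = G_{w_1} ∘ ⋯ ∘ G_{w_m}` for a word `w = w_1 ⋯ w_m`. -/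
def Gw : List (Fin 3) → EuclideanSpace ℝ (Fin 2) → EuclideanSpace ℝ (Fin 2)
  | [] => id
  | i :: w => T.G i ∘ Gw w

/-- The points `p_{ij} = G_i(p_j)`. -/
def pp (i j : Fin 3) : EuclideanSpace ℝ (Fin 2) := T.G i (T.p j)

/-- The segment `e_{ij} = p_{ij} p_{ji}` for the bond `(i, j) = (b, b + 1)`; over `b : Fin 3`
(addition modulo `3`) these are the bonds `(1, 2), (2, 3), (3, 1)`. -/
def bond (b : Fin 3) : Set (EuclideanSpace ℝ (Fin 2)) :=
  segment ℝ (T.pp b (b + 1)) (T.pp (b + 1) b)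

/-- The coding map `s ↦ lim_m G_{s_1} ∘ ⋯ ∘ G_{s_m}(x)`, written as a series. -/
def code (s : ℕ → Fin 3) : EuclideanSpace ℝ (Fin 2) :=
  ∑' n, ((1 - (1 - T.α) / 2) * ((1 - T.α) / 2) ^ n) • T.p (s n)

/-- The Cantor set `Σ`, the self-similar set of `G_1, G_2, G_3` (see `cantorSet_spec`). -/
def cantorSet : Set (EuclideanSpace ℝ (Fin 2)) := Set.range T.code

/-- The stretched Sierpinski gasket: `Σ` together with all segments `e_{ij}^w = G_w(e_{ij})`
(see `K_eq`). -/
def K : Set (EuclideanSpace ℝ (Fin 2)) :=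
  T.cantorSet ∪ ⋃ (w : List (Fin 3)) (b : Fin 3), T.Gw w '' T.bond b

theorem G_eq (i : Fin 3) (x : EuclideanSpace ℝ (Fin 2)) :
    T.G i x = ((1 - T.α) / 2) • x + (1 - (1 - T.α) / 2) • T.p i := by
  unfold G
  module

theorem term_bound : ∃ C : ℝ, ∀ i, ‖T.p i‖ ≤ C :=
  ⟨∑ i, ‖T.p i‖, fun i =>
    Finset.single_le_sum (f := fun i => ‖T.p i‖) (fun _ _ => norm_nonneg _) (Finset.mem_univ i)⟩

theorem ratio_pos : 0 < (1 - T.α) / 2 := by have := T.α_lt_one; linarith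

theorem ratio_lt_one : (1 - T.α) / 2 < 1 := by have := T.α_pos; linarith

theorem exists_bound : ∃ a : ℕ → ℝ, Summable a ∧ ∀ n (s : ℕ → Fin 3),
    ‖((1 - (1 - T.α) / 2) * ((1 - T.α) / 2) ^ n) • T.p (s n)‖ ≤ a n := by
  obtain ⟨C, hC⟩ := T.term_bound
  have h0 := T.ratio_pos
  have h1 := T.ratio_lt_one
  refine ⟨fun n => ((1 - (1 - T.α) / 2) * ((1 - T.α) / 2) ^ n) * C,
    ((summable_geometric_of_lt_one h0.le h1).mul_left _).mul_right _, fun n s => ?_⟩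
  have hn : 0 ≤ (1 - (1 - T.α) / 2) * ((1 - T.α) / 2) ^ n :=
    mul_nonneg (by linarith) (by positivity)
  rw [norm_smul, Real.norm_of_nonneg hn]
  exact mul_le_mul_of_nonneg_left (hC _) hn

theorem code_eq (s : ℕ → Fin 3) : T.code s = T.G (s 0) (T.code fun n => s (n + 1)) := by
  obtain ⟨a, ha, hb⟩ := T.exists_bound
  have hs : ∀ s : ℕ → Fin 3, Summable fun n =>
      ((1 - (1 - T.α) / 2) * ((1 - T.α) / 2) ^ n) • T.p (s n) :=
    fun s => Summable.of_norm_bounded ha fun n => hb n s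
  rw [G_eq]
  unfold code
  rw [(hs s).tsum_eq_zero_add, ← (hs fun n => s (n + 1)).tsum_const_smul, add_comm]
  congr 1
  · refine tsum_congr fun n => ?_
    rw [smul_smul]
    congr 1
    ring
  · simp

/-- `Σ` is a nonempty compact set with `Σ = G_1(Σ) ∪ G_2(Σ) ∪ G_3(Σ)`. -/
theorem cantorSet_spec :
    T.cantorSet.Nonempty ∧ IsCompact T.cantorSet ∧
      T.cantorSet = ⋃ i, T.G i '' T.cantorSet := by
  refine ⟨Set.range_nonempty _, ?_, ?_⟩
  · obtain ⟨a, ha, hb⟩ := T.exists_bound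
    refine isCompact_range (continuous_tsum (fun n => ?_) ha hb)
    have hc : Continuous fun s : ℕ → Fin 3 => T.p (s n) :=
      continuous_of_discreteTopology.comp (continuous_apply n)
    exact hc.const_smul ((1 - (1 - T.α) / 2) * ((1 - T.α) / 2) ^ n)
  · apply Set.Subset.antisymm
    · rintro _ ⟨s, rfl⟩
      exact Set.mem_iUnion.2 ⟨s 0, _, ⟨_, rfl⟩, (T.code_eq s).symm⟩
    · intro x hx
      obtain ⟨i, _, ⟨s, rfl⟩, rfl⟩ := Set.mem_iUnion.1 hx
      set s' : ℕ → Fin 3 := fun n => match n with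
        | 0 => i
        | k + 1 => s k with hs'
      have h := T.code_eq s'
      have h0 : s' 0 = i := rfl
      have h1 : (fun n => s' (n + 1)) = s := rfl
      rw [h0, h1] at h
      exact ⟨s', h⟩

/-- `K` satisfies `K = G_1(K) ∪ G_2(K) ∪ G_3(K) ∪ e_{12} ∪ e_{23} ∪ e_{31}`. -/
theorem K_eq : T.K = (⋃ i, T.G i '' T.K) ∪ ⋃ b, T.bond b := by
  apply Set.Subset.antisymm
  · rintro x (hx | hx)
    · rw [T.cantorSet_spec.2.2] at hx
      obtain ⟨i, y, hy, rfl⟩ := Set.mem_iUnion.1 hx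
      exact Or.inl (Set.mem_iUnion.2 ⟨i, y, Or.inl hy, rfl⟩)
    · simp only [Set.mem_iUnion] at hx
      obtain ⟨w, b, y, hy, rfl⟩ := hx
      cases w with
      | nil => exact Or.inr (Set.mem_iUnion.2 ⟨b, hy⟩)
      | cons i w =>
        refine Or.inl (Set.mem_iUnion.2 ⟨i, T.Gw w y, Or.inr ?_, rfl⟩)
        exact Set.mem_iUnion₂.2 ⟨w, b, y, hy, rfl⟩
  · rintro x (hx | hx)
    · obtain ⟨i, y, hy | hy, rfl⟩ := Set.mem_iUnion.1 hx
      · refine Or.inl ?_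
        rw [T.cantorSet_spec.2.2]
        exact Set.mem_iUnion.2 ⟨i, y, hy, rfl⟩
      · simp only [Set.mem_iUnion] at hy
        obtain ⟨w, b, z, hz, rfl⟩ := hy
        exact Or.inr (Set.mem_iUnion₂.2 ⟨i :: w, b, z, hz, rfl⟩)
    · obtain ⟨b, hb⟩ := Set.mem_iUnion.1 hx
      exact Or.inr (Set.mem_iUnion₂.2 ⟨[], b, x, hb, rfl⟩)

/-- `Σ` as a subset of the space `K`. -/
def cantor : Set T.K := {x | (x : EuclideanSpace ℝ (Fin 2)) ∈ T.cantorSet}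

theorem cantor_nonempty : T.cantor.Nonempty := by
  obtain ⟨x, hx⟩ := T.cantorSet_spec.1
  exact ⟨⟨x, Or.inl hx⟩, hx⟩

/-- `G_i` as a map `K → K`. -/
def GK (i : Fin 3) (x : T.K) : T.K :=
  ⟨T.G i x, T.K_eq.symm.subset (Or.inl (Set.mem_iUnion.2 ⟨i, x, x.2, rfl⟩))⟩

/-- The affine parametrization of `e_{ij}^w`, `(i, j) = (b, b + 1)`, from `G_w(p_{ij})` to
`G_w(p_{ji})` over `[0, 1]`. -/
def edge (w : List (Fin 3)) (b : Fin 3) (t : unitInterval) : T.K :=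
  ⟨T.Gw w (AffineMap.lineMap (T.pp b (b + 1)) (T.pp (b + 1) b) (t : ℝ)),
    Or.inr (Set.mem_iUnion₂.2 ⟨w, b, _, by
      rw [bond, segment_eq_image_lineMap]; exact ⟨t, t.2, rfl⟩, rfl⟩)⟩

/-- The continuous functions on `K` that are `H¹` on every segment `e_{ij}^w`. -/
def IsSegmentwiseH1 (u : T.K → ℝ) : Prop :=
  Continuous u ∧ ∀ (w : List (Fin 3)) (b : Fin 3), MemH1 (u ∘ T.edge w b)

/-- The form `D_m^I` with `m = k + 1`: the sum of the Dirichlet integrals over the segments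
`e_{ij}^w` with `w` a word of length `k = m - 1`. -/
def segmentForm (k : ℕ) (u v : T.K → ℝ) : ℝ :=
  ∑ w : Fin k → Fin 3, ∑ b : Fin 3,
    dirichletIntegral (u ∘ T.edge (List.ofFn w) b) (v ∘ T.edge (List.ofFn w) b)

/-- The class `RF_S^{(0)}` of resistance forms on `K`. -/
structure IsSymmetricForm (E : ResistanceForm T.K) : Prop where
  continuous : ∀ u ∈ E.dom, Continuous u
  mem_dom_iff : ∀ u : T.K → ℝ, u ∈ E.dom ↔
    (∀ i, (Set.range (T.GK i)).domRestrict u ∈ E.traceDom (Set.range (T.GK i))) ∧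
      ∀ b, MemH1 (u ∘ T.edge [] b)
  /-- The resistance metric induces the Euclidean topology of `K`. -/
  nhds_eq : ∀ x, 𝓝 x = comap (fun y => E.resistance x y) (𝓝 0)
  /-- Invariance under the linear maps `φ` of the plane with `φ(K) = K`. -/
  symmetric : ∀ (φ : EuclideanSpace ℝ (Fin 2) →ₗ[ℝ] EuclideanSpace ℝ (Fin 2)) (hφ : φ '' T.K = T.K)
    (u : E.dom),
    ∃ h : (fun x : T.K => (u : T.K → ℝ) ⟨φ x, hφ.subset (Set.mem_image_of_mem φ x.2)⟩) ∈ E.dom,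
      E.form ⟨_, h⟩ ⟨_, h⟩ = E.form u u

/-- `(E_m, η_m)` is a resolution of `E`; the value `η 0` plays no role. -/
structure IsResolution (E : ResistanceForm T.K) (Em : ℕ → ResistanceForm T.K) (η : ℕ → ℝ) :
    Prop where
  isSymmetricForm : ∀ m, T.IsSymmetricForm (Em m)
  zero : Em 0 = E
  pos : ∀ m, 0 < η (m + 1)
  dom_eq : ∀ m i, ((Em (m + 1)).dom : Set (T.K → ℝ)) =
    {v | ∃ u ∈ (Em m).dom, v = u ∘ T.GK i}
  form_eq : ∀ m (u v : (Em m).dom), (Em m).form u v =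
    (∑ i, (Em (m + 1)).form
      ⟨(u : T.K → ℝ) ∘ T.GK i, (dom_eq m i).symm.subset ⟨u, u.2, rfl⟩⟩
      ⟨(v : T.K → ℝ) ∘ T.GK i, (dom_eq m i).symm.subset ⟨v, v.2, rfl⟩⟩)
      + 1 / η (m + 1) * T.segmentForm 0 u v

/-- The class `RF_S` of completely symmetric resistance forms on `K`. -/
def IsCompletelySymmetric (E : ResistanceForm T.K) : Prop :=
  T.IsSymmetricForm E ∧ ∃ Em η, T.IsResolution E Em η

end StretchData

end

/-! ### Orthogonal splitting and energy limits in a general resistance form -/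

namespace ResistanceForm

variable {X : Type*} (E : ResistanceForm X)

/-! The splitting into harmonic and vanishing functions is orthogonal, because minimality means
orthogonality to everything vanishing on the boundary set. Pythagoras then gives the trace term plus
the energy of f = u - h_Σ(u), so all that remains is to show that a function vanishing on Σ has no
energy beyond that of the segments.

Cut such an f down to the segments of level less than m. The result stays in the domain: axiom (a)
glues functions from cells and bonds, and these pieces meet only at points of Σ, where f is zero.
Unfolding the resolution m times splits the energy of f exactly into the m-th partial sum of the
series and the energy of the remainder (`form_truncate`).

No energy escapes in the limit. The exact splitting makes the truncations Cauchy, and they converge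
pointwise to f since every point off Σ lies on a segment of finite level. Completeness and the
resistance estimate identify the energy limit with f (`exists_tendsto_of_pointwise`), so the
remainder energies tend to zero (`hasSum_segmentForm`). -/

theorem form_const_right (u : E.dom) (c : ℝ) : E.form u ⟨_, E.const_mem c⟩ = 0 := by
  have hcc : E.form ⟨_, E.const_mem c⟩ ⟨_, E.const_mem c⟩ = 0 :=
    (E.eq_zero_iff _).2 ⟨c, fun _ => rfl⟩
  -- Without boundary constraint a function of zero energy is a minimizer, hence orthogonal to all
  -- of F.
  have hh : E.IsHarmonicExt (∅ : Set X) (E.toTrace ∅ ⟨_, E.const_mem c⟩) ⟨_, E.const_mem c⟩ :=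
    ⟨rfl, fun a _ => by rw [hcc]; exact E.nonneg a⟩
  rw [E.symm]
  exact (E.isHarmonicExt_iff.1 hh).2 u (fun x hx => hx.elim)

theorem form_add_const_self (u : E.dom) (c : ℝ) :
    E.form (u + ⟨_, E.const_mem c⟩) (u + ⟨_, E.const_mem c⟩) = E.form u u := by
  rw [form_add_self, form_const_right, form_const_right]
  ring

/-- A Cauchy sequence in `F` which converges pointwise to `f`, and whose values at one point
are fixed, converges to `f` in energy. -/
theorem exists_tendsto_of_pointwise (u : ℕ → E.dom) (f : X → ℝ) (y : X)
    (hc : ∀ ε : ℝ, 0 < ε → ∃ N, ∀ m ≥ N, ∀ n ≥ N, E.form (u m - u n) (u m - u n) < ε)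
    (hf : ∀ x, Tendsto (fun n => (u n : X → ℝ) x) atTop (𝓝 (f x))) :
    ∃ h : f ∈ E.dom,
      Tendsto (fun n => E.form (u n - ⟨f, h⟩) (u n - ⟨f, h⟩)) atTop (𝓝 0) := by
  obtain ⟨v, hv⟩ := E.complete u hc
  -- Completeness gives a limit only modulo constants. The resistance bound controls differences of
  -- values by energy, so f and v differ by a constant, and constants cost no energy.
  have hpt : ∀ x, f x = (v : X → ℝ) x + (f y - (v : X → ℝ) y) := by
    intro x
    have hlim : Tendsto (fun n => E.resistance x y * E.form (u n - v) (u n - v)) atTop (𝓝 0) := by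
      simpa using hv.const_mul (E.resistance x y)
    have hlim' : Tendsto (fun n => |((u n : X → ℝ) x - (v : X → ℝ) x)
        - ((u n : X → ℝ) y - (v : X → ℝ) y)| ^ 2) atTop
        (𝓝 (|(f x - (v : X → ℝ) x) - (f y - (v : X → ℝ) y)| ^ 2)) :=
      ((((hf x).sub_const _).sub ((hf y).sub_const _)).abs).pow 2
    have hle := le_of_tendsto_of_tendsto' hlim' hlim fun n => E.sq_sub_le (u n - v) x y
    have h4 := abs_eq_zero.1 (pow_eq_zero_iff two_ne_zero |>.1 (le_antisymm hle (sq_nonneg _)))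
    linarith
  have hfv : f = ((v + ⟨_, E.const_mem (f y - (v : X → ℝ) y)⟩ : E.dom) : X → ℝ) := funext hpt
  have hmem : f ∈ E.dom := by
    rw [hfv]
    exact Subtype.mem _
  refine ⟨hmem, ?_⟩
  have heq : ∀ n, u n - ⟨f, hmem⟩
      = (u n - v) + ⟨_, E.const_mem (-(f y - (v : X → ℝ) y))⟩ := by
    intro n
    apply Subtype.ext
    funext x
    change (u n : X → ℝ) x - f x = (u n : X → ℝ) x - (v : X → ℝ) x + -(f y - (v : X → ℝ) y)
    rw [hpt x]
    ring
  simpa only [heq, form_add_const_self] using hv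

variable {Y : Set X} (hY : Y.Nonempty)

theorem sub_harmonicPart_mem_vanishing (u : E.dom) :
    u - E.harmonicPart Y hY u ∈ E.vanishing Y := by
  rw [mem_vanishing_iff, map_sub, harmonicPart, (E.harmonicExt_spec hY _).1, sub_self]

/-- The decomposition of `F` into the functions harmonic off `Y` and those vanishing on `Y`. -/
theorem isCompl_harmonic_vanishing : IsCompl (E.harmonic Y hY) (E.vanishing Y) := by
  constructor
  · rw [Submodule.disjoint_def]
    rintro _ ⟨f, rfl⟩ hv
    rw [mem_vanishing_iff, (E.harmonicExt_spec hY _).1] at hv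
    rw [hv, map_zero]
  · rw [codisjoint_iff, eq_top_iff]
    intro u _
    exact Submodule.mem_sup.2 ⟨E.harmonicPart Y hY u, ⟨_, rfl⟩, u - E.harmonicPart Y hY u,
      E.sub_harmonicPart_mem_vanishing hY u, add_sub_cancel _ _⟩

/-- Pythagoras: the harmonic part is orthogonal to the remainder, which vanishes on Y. -/
theorem form_self_eq_traceForm_add (u : E.dom) :
    E.form u u = E.traceForm Y hY (E.toTrace Y u) (E.toTrace Y u)
      + E.form (u - E.harmonicPart Y hY u) (u - E.harmonicPart Y hY u) := by
  have h := E.form_add_self (E.harmonicPart Y hY u) (u - E.harmonicPart Y hY u)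
  rw [add_sub_cancel] at h
  have h0 := (E.isHarmonicExt_iff.1 (E.harmonicExt_spec hY (E.toTrace Y u))).2 _
    (E.sub_harmonicPart_mem_vanishing hY u)
  have h1 : E.form (E.harmonicPart Y hY u) (u - E.harmonicPart Y hY u) = 0 := h0
  rw [h, h1, mul_zero, add_zero]
  rfl

end ResistanceForm

namespace StretchData

variable (T : StretchData)

/-! ### Barycentric coordinates -/

/-- The barycentric coordinate of `x` with respect to the vertex `p_i`. -/
noncomputable def bary (i : Fin 3) (x : EuclideanSpace ℝ (Fin 2)) : ℝ := 1 / 3 + 2 * inner ℝ (T.p i) x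

theorem sum_p (x : EuclideanSpace ℝ (Fin 2)) :
    inner ℝ (T.p 0) x + inner ℝ (T.p 1) x + inner ℝ (T.p 2) x = 0 := by
  rw [← inner_add_left, ← inner_add_left, T.sum_eq_zero, inner_zero_left]

theorem bary_sum (x : EuclideanSpace ℝ (Fin 2)) :
    T.bary 0 x + T.bary 1 x + T.bary 2 x = 1 := by
  have := T.sum_p x
  unfold bary
  linarith

/-- These values follow from the unit side lengths and the centring at the origin; they explain the
normalization 1/3 + 2⟨p_i, x⟩ in `bary`, which makes it 1 at p_i and 0 at the other vertices. -/
theorem inner_p (i j : Fin 3) :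
    (inner ℝ (T.p i) (T.p j) : ℝ) = if i = j then 1 / 3 else -1 / 6 := by
  have hd : ∀ i j, i ≠ j → inner ℝ (T.p i) (T.p i) - 2 * inner ℝ (T.p i) (T.p j)
      + inner ℝ (T.p j) (T.p j) = (1 : ℝ) := by
    intro i j hij
    have h := T.dist_eq_one i j hij
    rw [dist_eq_norm] at h
    have h2 := norm_sub_sq_real (T.p i) (T.p j)
    rw [h, ← real_inner_self_eq_norm_sq, ← real_inner_self_eq_norm_sq] at h2
    linarith
  have h01 := hd 0 1 (by decide)
  have h12 := hd 1 2 (by decide)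
  have h02 := hd 0 2 (by decide)
  have s0 := T.sum_p (T.p 0)
  have s1 := T.sum_p (T.p 1)
  have s2 := T.sum_p (T.p 2)
  have c10 := real_inner_comm (T.p 0) (T.p 1)
  have c20 := real_inner_comm (T.p 0) (T.p 2)
  have c21 := real_inner_comm (T.p 1) (T.p 2)
  fin_cases i <;> fin_cases j <;> simp [-inner_self_eq_norm_sq_to_K] <;> linarith

theorem bary_p (i j : Fin 3) : T.bary i (T.p j) = if i = j then 1 else 0 := by
  rw [bary, inner_p]
  split_ifs <;> norm_num

theorem bary_lineMap (i : Fin 3) (x y : EuclideanSpace ℝ (Fin 2)) (t : ℝ) :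
    T.bary i (AffineMap.lineMap x y t) = (1 - t) * T.bary i x + t * T.bary i y := by
  rw [bary, AffineMap.lineMap_apply_module, inner_add_right, inner_smul_right, inner_smul_right,
    bary, bary]
  ring

theorem G_eq_lineMap (i : Fin 3) (x : EuclideanSpace ℝ (Fin 2)) :
    T.G i x = AffineMap.lineMap (T.p i) x ((1 - T.α) / 2) := by
  rw [G_eq, AffineMap.lineMap_apply_module, add_comm]

theorem bary_G (i j : Fin 3) (x : EuclideanSpace ℝ (Fin 2)) :
    T.bary i (T.G j x) = (1 - (1 - T.α) / 2) * (if i = j then 1 else 0)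
      + (1 - T.α) / 2 * T.bary i x := by
  rw [G_eq_lineMap, bary_lineMap, bary_p]

theorem bary_bond (i b : Fin 3) (t : ℝ) :
    T.bary i (AffineMap.lineMap (T.pp b (b + 1)) (T.pp (b + 1) b) t) =
      (1 - t) * ((1 - (1 - T.α) / 2) * (if i = b then 1 else 0)
        + (1 - T.α) / 2 * (if i = b + 1 then 1 else 0))
      + t * ((1 - (1 - T.α) / 2) * (if i = b + 1 then 1 else 0)
        + (1 - T.α) / 2 * (if i = b then 1 else 0)) := by
  rw [bary_lineMap, pp, pp, bary_G, bary_G, bary_p, bary_p]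

theorem G_injective (i : Fin 3) : Function.Injective (T.G i) := by
  intro x y h
  rw [G_eq, G_eq, add_left_inj] at h
  exact smul_right_injective _ T.ratio_pos.ne' h

theorem continuous_bary (i : Fin 3) : Continuous (T.bary i) := by
  unfold bary
  fun_prop

/-- Let m be the minimum over the compact set Σ, attained at some G_j(z) with z in Σ. With
contraction ratio r < 1, the formula for `bary` after G_j gives m ≥ r · bary(z) ≥ r m, so m ≥ 0. -/
theorem bary_cantorSet_nonneg (i : Fin 3) {x : EuclideanSpace ℝ (Fin 2)}
    (hx : x ∈ T.cantorSet) : 0 ≤ T.bary i x := by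
  obtain ⟨y, hy, hmin⟩ := T.cantorSet_spec.2.1.exists_isMinOn T.cantorSet_spec.1
    (T.continuous_bary i).continuousOn
  refine le_trans ?_ (hmin hx)
  rw [T.cantorSet_spec.2.2] at hy
  obtain ⟨j, z, hz, rfl⟩ := Set.mem_iUnion.1 hy
  have h1 : T.bary i (T.G j z) ≤ T.bary i z := hmin hz
  have h2 := T.bary_G i j z
  have h3 := T.ratio_pos
  have h4 := T.ratio_lt_one
  have h5 : (0 : ℝ) ≤ (1 - (1 - T.α) / 2) * (if i = j then 1 else 0) :=
    mul_nonneg (by linarith) (by split_ifs <;> norm_num)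
  by_contra hneg
  push Not at hneg
  nlinarith

theorem bary_nonneg (i : Fin 3) {x : EuclideanSpace ℝ (Fin 2)} (hx : x ∈ T.K) :
    0 ≤ T.bary i x := by
  have h3 := T.ratio_pos
  have h4 : (0 : ℝ) < 1 - (1 - T.α) / 2 := by linarith [T.ratio_lt_one]
  rcases hx with hx | hx
  · exact T.bary_cantorSet_nonneg i hx
  · obtain ⟨w, b, y, hy, rfl⟩ := Set.mem_iUnion₂.1 hx
    have hw : 0 ≤ T.bary i y := by
      rw [bond, segment_eq_image_lineMap] at hy
      obtain ⟨t, ht, rfl⟩ := hy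
      have h1 : 0 ≤ 1 - t := by linarith [ht.2]
      have h2 : 0 ≤ t := ht.1
      rw [bary_bond]
      split_ifs <;> positivity
    clear hx hy
    induction w with
    | nil => exact hw
    | cons j w ih =>
      change 0 ≤ T.bary i (T.G j (T.Gw w y))
      rw [bary_G]
      split_ifs <;> positivity

/-! ### Cells and bonds -/

theorem bary_add_le_one {i j : Fin 3} (hij : i ≠ j) {x : EuclideanSpace ℝ (Fin 2)}
    (hx : x ∈ T.K) : T.bary i x + T.bary j x ≤ 1 := by
  have h := T.bary_sum x
  have h0 := T.bary_nonneg 0 hx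
  have h1 := T.bary_nonneg 1 hx
  have h2 := T.bary_nonneg 2 hx
  fin_cases i <;> fin_cases j <;> simp at hij ⊢ <;> linarith

/-- The bound exceeds 1/2, while two distinct coordinates sum to at most 1 on K; this is what
separates the cells. -/
theorem le_bary_GK (i : Fin 3) (x : T.K) : (1 + T.α) / 2 ≤ T.bary i (T.GK i x) := by
  have h := T.bary_G i i x
  have h1 := mul_nonneg T.ratio_pos.le (T.bary_nonneg i x.2)
  change _ ≤ T.bary i (T.G i x)
  rw [h, if_pos rfl]
  linarith

theorem GK_injective (i : Fin 3) : Function.Injective (T.GK i) := fun _ _ h =>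
  Subtype.ext (T.G_injective i (congrArg Subtype.val h))

/-- The cells `G_i(K)` are pairwise disjoint. -/
theorem eq_of_GK_eq {i j : Fin 3} {x y : T.K} (h : T.GK i x = T.GK j y) : i = j := by
  by_contra hij
  have h1 := T.le_bary_GK i x
  have h2 := T.le_bary_GK j y
  have h3 := T.bary_add_le_one hij (T.GK i x).2
  rw [← h] at h2
  linarith [T.α_pos]

/-- The constant sequence i codes the fixed point of G_i. -/
theorem p_mem_cantorSet (i : Fin 3) : T.p i ∈ T.cantorSet := by
  refine ⟨fun _ => i, ?_⟩
  have h := T.code_eq fun _ => i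
  rw [G_eq] at h
  have h4 : (0 : ℝ) < 1 - (1 - T.α) / 2 := by linarith [T.ratio_lt_one]
  refine smul_right_injective _ h4.ne' ?_
  change (1 - (1 - T.α) / 2) • T.code (fun _ => i) = (1 - (1 - T.α) / 2) • T.p i
  rw [sub_smul, one_smul, sub_eq_iff_eq_add']
  exact h

theorem G_mem_cantorSet (i : Fin 3) {x : EuclideanSpace ℝ (Fin 2)} (hx : x ∈ T.cantorSet) :
    T.G i x ∈ T.cantorSet := by
  rw [T.cantorSet_spec.2.2]
  exact Set.mem_iUnion.2 ⟨i, x, hx, rfl⟩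

/-- A bond meets the cells only in points of the Cantor set. -/
theorem mem_cantor_of_GK_eq_edge {i b : Fin 3} {x : T.K} {t : unitInterval}
    (h : T.GK i x = T.edge [] b t) : T.edge [] b t ∈ T.cantor := by
  have h1 := T.le_bary_GK i x
  rw [h] at h1
  have hα := T.α_pos
  have hα' := T.α_lt_one
  have ht0 := t.2.1
  have ht1 := t.2.2
  change _ ≤ T.bary i (AffineMap.lineMap (T.pp b (b + 1)) (T.pp (b + 1) b) (t : ℝ)) at h1
  change AffineMap.lineMap (T.pp b (b + 1)) (T.pp (b + 1) b) (t : ℝ) ∈ T.cantorSet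
  rw [bary_bond] at h1
  have hb : b ≠ b + 1 := by fin_cases b <;> decide
  -- Along the bond the coordinate is (1+α)/2 - tα for i = b, (1+α)/2 - (1-t)α for i = b + 1, and 0
  -- for the third index. The lower bound valid on a cell therefore leaves only the two endpoints,
  -- which are images of vertices.
  by_cases hib : i = b
  · subst hib
    rw [if_pos rfl, if_neg hb] at h1
    have ht : (t : ℝ) = 0 := by
      by_contra hne
      have : 0 < (t : ℝ) * T.α := mul_pos (lt_of_le_of_ne ht0 (Ne.symm hne)) hα
      linarith
    rw [ht, AffineMap.lineMap_apply_zero]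
    exact T.G_mem_cantorSet _ (T.p_mem_cantorSet _)
  · rw [if_neg hib] at h1
    by_cases hib' : i = b + 1
    · rw [if_pos hib'] at h1
      have ht : (t : ℝ) = 1 := by
        by_contra hne
        have : 0 < (1 - (t : ℝ)) * T.α :=
          mul_pos (sub_pos.2 (lt_of_le_of_ne ht1 hne)) hα
        linarith
      rw [ht, AffineMap.lineMap_apply_one]
      exact T.G_mem_cantorSet _ (T.p_mem_cantorSet _)
    · rw [if_neg hib'] at h1
      linarith

theorem GK_mem_cantor (i : Fin 3) {x : T.K} (hx : x ∈ T.cantor) : T.GK i x ∈ T.cantor :=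
  T.G_mem_cantorSet i hx

theorem edge_cons (i : Fin 3) (w : List (Fin 3)) (b : Fin 3) :
    T.edge (i :: w) b = T.GK i ∘ T.edge w b := rfl

theorem exists_edge_eq_of_notMem_cantor {x : T.K} (hx : x ∉ T.cantor) :
    ∃ w b t, T.edge w b t = x := by
  obtain ⟨w, b, y, hy, hyx⟩ := Set.mem_iUnion₂.1 (x.2.resolve_left hx)
  rw [bond, segment_eq_image_lineMap] at hy
  obtain ⟨t, ht, rfl⟩ := hy
  exact ⟨w, b, ⟨t, ht⟩, Subtype.ext hyx⟩

/-! ### Truncation to the segments of finite level -/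

/-- The union of the segments `e_{ij}^w` with `w` of length less than `m`. -/
def skeleton (m : ℕ) : Set T.K := {x | ∃ w b t, w.length < m ∧ T.edge w b t = x}

/-- The function equal to `f` on the segments of level less than `m`, and to `0` elsewhere. -/
noncomputable def truncate (m : ℕ) (f : T.K → ℝ) : T.K → ℝ := (T.skeleton m).indicator f

theorem skeleton_mono {m n : ℕ} (h : m ≤ n) : T.skeleton m ⊆ T.skeleton n := by
  rintro x ⟨w, b, t, hw, rfl⟩
  exact ⟨w, b, t, hw.trans_le h, rfl⟩

theorem truncate_zero (f : T.K → ℝ) : T.truncate 0 f = 0 := by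
  funext x
  refine Set.indicator_of_notMem ?_ _
  rintro ⟨w, b, t, hw, -⟩
  exact Nat.not_lt_zero _ hw

theorem truncate_succ_comp_edge (m : ℕ) (f : T.K → ℝ) (b : Fin 3) :
    T.truncate (m + 1) f ∘ T.edge [] b = f ∘ T.edge [] b := by
  funext t
  exact Set.indicator_of_mem (s := T.skeleton (m + 1)) ⟨[], b, t, Nat.succ_pos m, rfl⟩ _

/-- Passing to a cell removes one letter from each word, hence lowers the level by one. Vanishing on
Σ is needed because a bond endpoint lying in the cell belongs to the larger skeleton, while its
preimage need not lie in the smaller one. -/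
theorem truncate_succ_comp_GK (m : ℕ) {f : T.K → ℝ} (hf : ∀ x ∈ T.cantor, f x = 0) (i : Fin 3) :
    T.truncate (m + 1) f ∘ T.GK i = T.truncate m (f ∘ T.GK i) := by
  classical
  funext x
  change Set.indicator _ _ _ = Set.indicator _ _ _
  rw [Set.indicator_apply, Set.indicator_apply, Function.comp_apply]
  by_cases hx : x ∈ T.skeleton m
  · rw [if_pos hx, if_pos]
    obtain ⟨w, b, t, hw, rfl⟩ := hx
    exact ⟨i :: w, b, t, Nat.succ_lt_succ hw, rfl⟩
  · rw [if_neg hx, ite_eq_right_iff]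
    rintro ⟨w, b, t, hw, he⟩
    cases w with
    | nil => exact he ▸ hf _ (T.mem_cantor_of_GK_eq_edge he.symm)
    | cons j w =>
      rw [edge_cons, Function.comp_apply] at he
      obtain rfl := T.eq_of_GK_eq he
      exact (hx ⟨w, b, t, Nat.lt_of_succ_lt_succ hw, T.GK_injective _ he⟩).elim

/-- A difference of two truncations is itself a truncation of a remainder, so the energy splitting
applies to it; this yields the Cauchy property. -/
theorem truncate_sub_truncate {m n : ℕ} (h : n ≤ m) (f : T.K → ℝ) :
    T.truncate m (f - T.truncate n f) = T.truncate m f - T.truncate n f := by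
  unfold truncate
  rw [Set.indicator_sub', Set.indicator_indicator, Set.inter_eq_right.2 (T.skeleton_mono h)]

theorem truncate_eq_zero (m : ℕ) {f : T.K → ℝ} {x : T.K} (hx : f x = 0) :
    T.truncate m f x = 0 :=
  Set.indicator_apply_eq_zero.2 fun _ => hx

/-- At each point the sequence is eventually constant: zero on Σ, and f(x) once m exceeds the level
of a segment through x. -/
theorem tendsto_truncate {f : T.K → ℝ} (hf : ∀ x ∈ T.cantor, f x = 0) (x : T.K) :
    Tendsto (fun m => T.truncate m f x) atTop (𝓝 (f x)) := by
  by_cases hx : x ∈ T.cantor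
  · simp only [truncate_eq_zero T _ (hf x hx), hf x hx, tendsto_const_nhds]
  · obtain ⟨w, b, t, he⟩ := T.exists_edge_eq_of_notMem_cantor hx
    refine tendsto_const_nhds.congr' ?_
    filter_upwards [eventually_gt_atTop w.length] with m hm
    exact (Set.indicator_of_mem (s := T.skeleton m) ⟨w, b, t, hm, he⟩ _).symm

/-! ### The segment forms -/

theorem segmentForm_zero_congr {u u' v v' : T.K → ℝ}
    (hu : ∀ b, u ∘ T.edge [] b = u' ∘ T.edge [] b)
    (hv : ∀ b, v ∘ T.edge [] b = v' ∘ T.edge [] b) :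
    T.segmentForm 0 u v = T.segmentForm 0 u' v' := by
  simp only [segmentForm, List.ofFn_zero, hu, hv]

/-- Words of length k + 1 are sorted by their first letter, which selects the cell. -/
theorem segmentForm_succ (k : ℕ) (u v : T.K → ℝ) :
    T.segmentForm (k + 1) u v = ∑ i, T.segmentForm k (u ∘ T.GK i) (v ∘ T.GK i) := by
  unfold segmentForm
  rw [← (Fin.consEquiv fun _ => Fin 3).sum_comp, Fintype.sum_prod_type]
  refine Finset.sum_congr rfl fun i _ => Finset.sum_congr rfl fun w _ =>
    Finset.sum_congr rfl fun b _ => ?_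
  have h : List.ofFn (Fin.consEquiv (fun _ => Fin 3) (i, w)) = i :: List.ofFn w :=
    List.ofFn_cons i w
  rw [h]
  rfl

theorem segmentForm_self_nonneg (k : ℕ) (u : T.K → ℝ) : 0 ≤ T.segmentForm k u u :=
  Finset.sum_nonneg fun _ _ => Finset.sum_nonneg fun _ _ =>
    integral_nonneg fun _ => mul_self_nonneg _

/-! ### Energy along a resolution -/

namespace IsResolution

variable {T} {E : ResistanceForm T.K} {Em : ℕ → ResistanceForm T.K} {η : ℕ → ℝ}

theorem comp_GK_mem (hres : T.IsResolution E Em η) (n : ℕ) (i : Fin 3) {u : T.K → ℝ}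
    (hu : u ∈ (Em n).dom) : u ∘ T.GK i ∈ (Em (n + 1)).dom :=
  (hres.dom_eq n i).symm.subset ⟨u, hu, rfl⟩

/-- Gluing: the domain relation of the resolution turns membership at level n + 1 into a member of
the level n domain agreeing with u on the cell, which is the cell condition in axiom (a). -/
theorem mem_dom_of_comp_GK (hres : T.IsResolution E Em η) (n : ℕ) {u : T.K → ℝ}
    (hG : ∀ i, u ∘ T.GK i ∈ (Em (n + 1)).dom) (he : ∀ b, MemH1 (u ∘ T.edge [] b)) :
    u ∈ (Em n).dom := by
  refine ((hres.isSymmetricForm n).mem_dom_iff u).2 ⟨fun i => ?_, he⟩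
  obtain ⟨v, hv, huv⟩ := (hres.dom_eq n i).subset (hG i)
  refine ⟨v, hv, ?_⟩
  funext x
  obtain ⟨y, hy⟩ := x.2
  have h : u (T.GK i y) = v (T.GK i y) := congrFun huv y
  rw [hy] at h
  exact h.symm

theorem memH1_comp_edge (hres : T.IsResolution E Em η) (w : List (Fin 3)) (b : Fin 3) :
    ∀ (n : ℕ) {u : T.K → ℝ}, u ∈ (Em n).dom → MemH1 (u ∘ T.edge w b) := by
  induction w with
  | nil => exact fun n u hu => (((hres.isSymmetricForm n).mem_dom_iff u).1 hu).2 b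
  | cons i w ih => exact fun n u hu => ih (n + 1) (hres.comp_GK_mem n i hu)

theorem form_self_eq (hres : T.IsResolution E Em η) (n : ℕ) {u : T.K → ℝ}
    (hu : u ∈ (Em n).dom) :
    (Em n).form ⟨u, hu⟩ ⟨u, hu⟩ =
      (∑ i, (Em (n + 1)).form ⟨_, hres.comp_GK_mem n i hu⟩ ⟨_, hres.comp_GK_mem n i hu⟩)
        + 1 / η (n + 1) * T.segmentForm 0 u u :=
  hres.form_eq n ⟨u, hu⟩ ⟨u, hu⟩

/-- `weakDeriv` is a choice, so it need not be literally zero here. Instead of proving uniqueness of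
weak derivatives, compare both sides of the resolution identity at the zero function: every energy
vanishes, and 1/η is positive. -/
theorem segmentForm_zero_zero (hres : T.IsResolution E Em η) :
    T.segmentForm 0 (0 : T.K → ℝ) 0 = 0 := by
  have h : ∀ n, (Em n).form ⟨(0 : T.K → ℝ), (Em n).dom.zero_mem⟩
      ⟨(0 : T.K → ℝ), (Em n).dom.zero_mem⟩ = 0 := fun n =>
    ((Em n).eq_zero_iff _).2 ⟨0, fun _ => rfl⟩
  have h1 := hres.form_self_eq 0 (Em 0).dom.zero_mem
  have h2 : ∀ i, (Em (0 + 1)).form ⟨_, hres.comp_GK_mem 0 i (Em 0).dom.zero_mem⟩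
      ⟨_, hres.comp_GK_mem 0 i (Em 0).dom.zero_mem⟩ = 0 := fun i => h 1
  rw [h, Finset.sum_eq_zero fun i _ => h2 i, zero_add] at h1
  exact (mul_eq_zero.1 h1.symm).resolve_left (one_div_pos.2 (hres.pos 0)).ne'

/-- Glue by induction on m. The level n stays general because the restrictions to cells live at
level n + 1. -/
theorem truncate_mem (hres : T.IsResolution E Em η) (m : ℕ) :
    ∀ (n : ℕ) {f : T.K → ℝ}, f ∈ (Em n).dom → (∀ x ∈ T.cantor, f x = 0) →
      T.truncate m f ∈ (Em n).dom := by
  induction m with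
  | zero =>
    intro n f _ _
    rw [truncate_zero]
    exact (Em n).dom.zero_mem
  | succ m ih =>
    intro n f hf h0
    refine hres.mem_dom_of_comp_GK n (fun i => ?_) fun b => ?_
    · rw [T.truncate_succ_comp_GK m h0]
      exact ih (n + 1) (hres.comp_GK_mem n i hf) fun x hx => h0 _ (T.GK_mem_cantor i hx)
    · rw [truncate_succ_comp_edge]
      exact hres.memH1_comp_edge [] b n hf

/-- A function vanishing on the Cantor set splits orthogonally into its truncation, whose energy
is carried by the segments of level less than `m`, and the remainder. -/
theorem form_truncate (hres : T.IsResolution E Em η) (m : ℕ) :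
    ∀ (n : ℕ) {f : T.K → ℝ} (hf : f ∈ (Em n).dom), (∀ x ∈ T.cantor, f x = 0) →
      ∀ {g r : T.K → ℝ} (hg : g ∈ (Em n).dom) (hr : r ∈ (Em n).dom),
      g = T.truncate m f → r = f - T.truncate m f →
      (Em n).form ⟨g, hg⟩ ⟨g, hg⟩ =
        ∑ k ∈ Finset.range m, 1 / η (n + k + 1) * T.segmentForm k f f ∧
      (Em n).form ⟨f, hf⟩ ⟨f, hf⟩ =
        (Em n).form ⟨g, hg⟩ ⟨g, hg⟩ + (Em n).form ⟨r, hr⟩ ⟨r, hr⟩ := by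
  induction m with
  | zero =>
    intro n f hf h0 g r hg hr hge hre
    rw [truncate_zero] at hge hre
    rw [sub_zero] at hre
    subst hre hge
    have h : (Em n).form ⟨0, hg⟩ ⟨0, hg⟩ = 0 := ((Em n).eq_zero_iff _).2 ⟨0, fun _ => rfl⟩
    simp [h]
  | succ m ih =>
    intro n f hf h0 g r hg hr hge hre
    have hG : ∀ i, g ∘ T.GK i = T.truncate m (f ∘ T.GK i) := fun i => by
      rw [hge, T.truncate_succ_comp_GK m h0]
    have hR : ∀ i, r ∘ T.GK i = f ∘ T.GK i - T.truncate m (f ∘ T.GK i) := fun i => by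
      rw [← T.truncate_succ_comp_GK m h0, hre]
      rfl
    have h0' : ∀ i, ∀ x ∈ T.cantor, (f ∘ T.GK i) x = 0 := fun i x hx =>
      h0 _ (T.GK_mem_cantor i hx)
    have hi := fun i => ih (n + 1) (hres.comp_GK_mem n i hf) (h0' i)
      (hres.comp_GK_mem n i hg) (hres.comp_GK_mem n i hr) (hG i) (hR i)
    have hsg : T.segmentForm 0 g g = T.segmentForm 0 f f :=
      T.segmentForm_zero_congr (fun b => by rw [hge, truncate_succ_comp_edge])
        fun b => by rw [hge, truncate_succ_comp_edge]
    -- On the bonds of level zero g equals f and r vanishes, so the whole bond energy goes to g.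
    -- Inside the cells the induction hypothesis does the splitting, and no cross term has to be
    -- computed.
    have hre0 : ∀ b, r ∘ T.edge [] b = (0 : T.K → ℝ) ∘ T.edge [] b := fun b => by
      have h : (f - T.truncate (m + 1) f) ∘ T.edge [] b
          = f ∘ T.edge [] b - T.truncate (m + 1) f ∘ T.edge [] b := rfl
      rw [hre, h, truncate_succ_comp_edge, sub_self]
      rfl
    have hsr : T.segmentForm 0 r r = 0 :=
      (T.segmentForm_zero_congr hre0 hre0).trans hres.segmentForm_zero_zero
    rw [hres.form_self_eq n hf, hres.form_self_eq n hg, hres.form_self_eq n hr, hsg, hsr,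
      Finset.sum_congr rfl fun i _ => (hi i).2, Finset.sum_add_distrib]
    refine ⟨?_, by ring⟩
    -- Splitting off the index k = 0 isolates the bond term; the remaining terms are the cell sums
    -- with k shifted by one.
    rw [Finset.sum_congr rfl fun i _ => (hi i).1, Finset.sum_comm, Finset.sum_range_succ']
    congr 1
    refine Finset.sum_congr rfl fun k _ => ?_
    rw [segmentForm_succ, Finset.mul_sum, show n + 1 + k + 1 = n + (k + 1) + 1 by omega]

/-- The energy of a function vanishing on the Cantor set is carried by the segments. -/
theorem hasSum_segmentForm (hres : T.IsResolution E Em η) {f : E.dom}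
    (hf : f ∈ E.vanishing T.cantor) :
    HasSum (fun k : ℕ => 1 / η (k + 1) * T.segmentForm k f f) (E.form f f) := by
  obtain rfl := hres.zero
  set S : ℕ → ℝ := fun m => ∑ k ∈ Finset.range m, 1 / η (k + 1) * T.segmentForm k f f with hS
  have hnn : ∀ k, 0 ≤ 1 / η (k + 1) * T.segmentForm k f f := fun k =>
    mul_nonneg (one_div_pos.2 (hres.pos k)).le (T.segmentForm_self_nonneg k _)
  let u : ℕ → (Em 0).dom := fun m => ⟨_, hres.truncate_mem m 0 f.2 hf⟩
  have hsplit : ∀ m, (Em 0).form (u m) (u m) = S m ∧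
      (Em 0).form f f = (Em 0).form (u m) (u m) + (Em 0).form (f - u m) (f - u m) := by
    intro m
    have h := hres.form_truncate m 0 f.2 hf (u m).2 (f - u m).2 rfl rfl
    simp only [Nat.zero_add] at h
    exact h
  have hrem : ∀ m, (Em 0).form (f - u m) (f - u m) = (Em 0).form f f - S m := fun m => by
    rw [(hsplit m).2, (hsplit m).1]
    ring
  -- Split the remainder f - u n, which also vanishes on Σ, at level m: its truncation is u m - u n
  -- and its own remainder is f - u m. Both remainder energies are known from `hrem`.
  have hdiff : ∀ n m, n ≤ m → (Em 0).form (u m - u n) (u m - u n) = S m - S n := by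
    intro n m hnm
    have h0 : ∀ x ∈ T.cantor, ((f - u n : (Em 0).dom) : T.K → ℝ) x = 0 := fun x hx => by
      change (f : T.K → ℝ) x - T.truncate n f x = 0
      rw [T.truncate_eq_zero n (hf x hx), hf x hx, sub_zero]
    have htr : T.truncate m (f - u n : (Em 0).dom) = (u m : T.K → ℝ) - u n :=
      T.truncate_sub_truncate hnm _
    have h := (hres.form_truncate m 0 (f - u n).2 h0 (u m - u n).2 (f - u m).2 htr.symm
      (by rw [htr]; exact (sub_sub_sub_cancel_right _ _ _).symm)).2
    have h' : (Em 0).form (f - u n) (f - u n) =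
      (Em 0).form (u m - u n) (u m - u n) + (Em 0).form (f - u m) (f - u m) := h
    rw [hrem, hrem] at h'
    linarith
  -- The terms are nonnegative, and nonnegativity of the remainder energy bounds the partial sums by
  -- the energy of f.
  have hsum : Summable fun k : ℕ => 1 / η (k + 1) * T.segmentForm k f f :=
    summable_of_sum_range_le hnn fun m => by
      have := (Em 0).nonneg (f - u m)
      rw [hrem] at this
      exact sub_nonneg.1 this
  have hlim := hsum.hasSum.tendsto_sum_nat
  have hcauchy : ∀ ε : ℝ, 0 < ε → ∃ N, ∀ m ≥ N, ∀ n ≥ N,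
      (Em 0).form (u m - u n) (u m - u n) < ε := by
    intro ε hε
    obtain ⟨N, hN⟩ := Metric.cauchySeq_iff.1 hlim.cauchySeq ε hε
    refine ⟨N, fun m hm n hn => ?_⟩
    have hlt := hN m hm n hn
    rw [Real.dist_eq] at hlt
    rcases le_total n m with h | h
    · rw [hdiff n m h]
      exact (le_abs_self _).trans_lt hlt
    · rw [← neg_sub, map_neg, map_neg, LinearMap.neg_apply, neg_neg, hdiff m n h]
      rw [abs_sub_comm] at hlt
      exact (le_abs_self _).trans_lt hlt
  obtain ⟨y, -⟩ := T.cantor_nonempty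
  obtain ⟨hmem, hconv⟩ := (Em 0).exists_tendsto_of_pointwise u f y hcauchy
    (T.tendsto_truncate hf)
  -- Energy convergence of the truncations to f itself says that the remainder energies vanish, so
  -- the sum is the full energy and not just a lower bound.
  have hconv' : Tendsto (fun m => (Em 0).form f f - S m) atTop (𝓝 0) := by
    refine hconv.congr fun m => ?_
    rw [← hrem m]
    change (Em 0).form (u m - f) (u m - f) = _
    rw [← neg_sub, map_neg, map_neg, LinearMap.neg_apply, neg_neg]
  have hlim2 : Tendsto S atTop (𝓝 ((Em 0).form f f)) := by
    simpa using hconv'.const_sub ((Em 0).form f f)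
  rw [tendsto_nhds_unique hlim2 hlim]
  exact hsum.hasSum

end IsResolution

end StretchData

theorem mainTheorem10 (T : StretchData) (E : ResistanceForm T.K)
    (hE : T.IsCompletelySymmetric E)
    (Em : ℕ → ResistanceForm T.K) (η : ℕ → ℝ) (hres : T.IsResolution E Em η) :
    IsCompl (E.harmonic T.cantor T.cantor_nonempty) (E.vanishing T.cantor) ∧
    (∀ u : E.dom, T.IsSegmentwiseH1 u) ∧
    ∀ u : E.dom,
      Summable (fun k : ℕ => 1 / η (k + 1) *
        T.segmentForm k ↑(u - E.harmonicPart T.cantor T.cantor_nonempty u)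
          ↑(u - E.harmonicPart T.cantor T.cantor_nonempty u)) ∧
      E.form u u =
        E.traceForm T.cantor T.cantor_nonempty (E.toTrace T.cantor u) (E.toTrace T.cantor u) +
        ∑' k : ℕ, 1 / η (k + 1) *
          T.segmentForm k ↑(u - E.harmonicPart T.cantor T.cantor_nonempty u)
            ↑(u - E.harmonicPart T.cantor T.cantor_nonempty u) := by
  refine ⟨E.isCompl_harmonic_vanishing T.cantor_nonempty, fun u => ⟨hE.1.continuous u u.2, ?_⟩,
    fun u => ?_⟩
  · intro w b
    obtain rfl := hres.zero
    exact hres.memH1_comp_edge w b 0 u.2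
  · have h := hres.hasSum_segmentForm (E.sub_harmonicPart_mem_vanishing T.cantor_nonempty u)
    exact ⟨h.summable, by rw [h.tsum_eq]; exact E.form_self_eq_traceForm_add T.cantor_nonempty u⟩
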